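/- Let $N\ge 2$ consumers schedule their energy consumption over $H$ time slots. Consumer $n$ chooses a profile $\mathbf q_n=(q_n^1,\dots,q_n^H)$ from $$\mathcal Q_n=\Big\{\mathbf q_n\in\mathbb R^H:\ \sum_{h=1}^H q_n^h=E_n,\ \ q_n^{h,\min}\le q_n^h\le q_n^{h,\max}\ \text{for all } h\Big\},$$ where all $q_n^{h,\min}\ge 0$. The price in slot $h$ at total load $L$ is $p_h(L)=a_hL^{b_h}+c_h$ with $a_h>0$, $b_h\ge 1$, $c_h\ge 0$; if $L<0$, which can only occur for an estimated load, $L^{b_h}$ stands for $|L|^{b_h}\cos(\pi b_h)$ (the ordinary power if $b_h$ is an integer). Consumer $n$ pays $$\mathcal B_n(\mathbf q_n,\mathbf q_\Sigma)=\sum_{h=1}^H p_h(q_\Sigma^h)\,q_n^h,\qquad \mathbf q_\Sigma=\sum_{m=1}^N\mathbf q_m .$$ A Nash equilibrium (NE) is a tuple $\mathbf q=(\mathbf q_n)_{n=1}^N$ with $\mathbf q_n\in\mathcal Q_n$ for all $n$ in which no consumer $n$ can lower the own cost by replacing $\mathbf q_n$ with another element of $\mathcal Q_n$ while the profiles of the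 others stay fixed. Let $\mathbf F_n(\mathbf q_n,\mathbf q_\Sigma)=\nabla_{\mathbf q_n}\mathcal B_n(\mathbf q_n,\mathbf q_\Sigma)$, the gradient in the own profile with the load $\mathbf q_\Sigma-\mathbf q_n$ of the others held fixed, that is, the vector with entries $p_h'(q_\Sigma^h)q_n^h+p_h(q_\Sigma^h)$. Let $\mathcal M$ be a connected undirected graph on the set of consumers, and let $\mathcal D_n$ be the set of neighbours of $n$. Let $w_{n,k}\ge 0$ be weights with $w_{n,k}=0$ if $k\notin\mathcal D_n$ and $k\ne n$, with $w_{n,k}>0$ if $k\in\mathcal D_n$, with $w_{n,n}>0$ for at least one $n$ in case $\mathcal M$ is bipartite, and with $$\sum_{k=1}^N w_{n,k}=1\ \text{ for all } n,\qquad \sum_{n=1}^N w_{n,k}=1\ \text{ for all } k .$$ Let the step sizes $\alpha(t)$ be monotonically decreasing in $t\ge 1$ (not necessarily strictly) with $\sum_t\alpha(t)=\infty$ and $\sum_t\alpha(t)^2<\infty$. The synchronous agreement-based algorithm starts at $t=1$ from any profiles $\mathbf q_n(1)\in\mathcal Q_n$ with the estimates $\hat{\mathbf q}_n(1)=\mathbf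 q_n(1)$ of the average consumption, and computes, for $t=1,2,\dots$ and all $n$, $$\tilde{\mathbf q}_n(t)=w_{n,n}\hat{\mathbf q}_n(t)+\sum_{k\in\mathcal D_n}w_{n,k}\hat{\mathbf q}_k(t),$$ $$\mathbf q_n(t+1)=\big[\mathbf q_n(t)-\alpha(t)\,\mathbf F_n\big(\mathbf q_n(t),N\tilde{\mathbf q}_n(t)\big)\big]_{\mathcal Q_n},$$ $$\hat{\mathbf q}_n(t+1)=\tilde{\mathbf q}_n(t)+\mathbf q_n(t+1)-\mathbf q_n(t),$$ where $[\,\cdot\,]_{\mathcal Q_n}$ is the Euclidean projection onto $\mathcal Q_n$. If $b_h<3+4/(N-1)$ for all $h$, then the game has exactly one NE $\mathbf q^\ast$, and every sequence $\mathbf q(t)=(\mathbf q_n(t))_{n=1}^N$ generated by the algorithm converges to $\mathbf q^\ast$. -/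

import Mathlib

open Filter Topology

namespace DSM

/-- A consumption profile of one consumer over `H` time slots, with the Euclidean norm. -/
abbrev Load (H : ℕ) : Type := EuclideanSpace ℝ (Fin H)

/-- The data of the demand side management game with `N` consumers and `H` time slots:
the price parameters of every slot, and the energy levels and total energy requirement of
every consumer. -/
structure Game (N H : ℕ) where
  /-- coefficient of the price in a slot -/
  a : Fin H → ℝ
  /-- exponent of the price in a slot -/
  b : Fin H → ℝ
  /-- constant term of the price in a slot -/
  c : Fin H → ℝ
  /-- minimum energy level of a consumer in a slot -/
  qmin : Fin N → Fin H → ℝ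
  /-- maximum energy level of a consumer in a slot -/
  qmax : Fin N → Fin H → ℝ
  /-- total energy requirement of a consumer -/
  E : Fin N → ℝ

namespace Game

variable {N H : ℕ} (g : Game N H)

/-- The price `p_h(L) = a_h L ^ b_h + c_h`. Feasible loads are nonnegative, but an estimated
aggregate load in the algorithm may be negative; there `L ^ b_h` is the real power function of
Mathlib, the real part `|L| ^ b_h * cos (π b_h)` of the principal value, which is the ordinary
power when `b_h` is an integer. It is continuously differentiable on `ℝ`, as `b_h ≥ 1`. -/
noncomputable def price (h : Fin H) (L : ℝ) : ℝ :=
  g.a h * L ^ g.b h + g.c h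

/-- The feasible set `Q_n` of consumer `n`. -/
def feasible (n : Fin N) : Set (Load H) :=
  {x | ∑ h, x h = g.E n ∧ ∀ h, g.qmin n h ≤ x h ∧ x h ≤ g.qmax n h}

/-- The total energy cost `B_n(x, s)` of a consumer whose own profile is `x` when the aggregate
profile is `s`. -/
noncomputable def bill (x s : Load H) : ℝ :=
  ∑ h, g.price h (s h) * x h

/-- `q` is a Nash equilibrium: it is feasible and no consumer lowers his or her own cost by
changing to another feasible profile (which also changes the aggregate profile). -/
def IsNash (q : Fin N → Load H) : Prop :=
  (∀ n, q n ∈ g.feasible n) ∧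
    ∀ n, ∀ y ∈ g.feasible n,
      g.bill (q n) (∑ m, q m) ≤ g.bill y (∑ m, Function.update q n y m)

/-- `F_n(x, s)`: the gradient of a consumer's cost in his or her own profile, taken at the own
profile `x` and the aggregate profile `s`. The load `s - x` of the others is held fixed, so
that the aggregate varies with the own profile. -/
noncomputable def gradBill (x s : Load H) : Load H :=
  gradient (fun y : Load H => g.bill y (y + (s - x))) x

end Game

/-- `x` is the Euclidean projection of `u` onto `K`. -/
def IsProjection {H : ℕ} (K : Set (Load H)) (u x : Load H) : Prop :=
  x ∈ K ∧ ∀ y ∈ K, ‖u - x‖ ≤ ‖u - y‖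

/-- The new estimate of consumer `n`: a weighted combination of the own estimate and of the
estimates of the neighbours in the graph `M`. -/
noncomputable def mix {N H : ℕ} (M : SimpleGraph (Fin N)) [DecidableRel M.Adj]
    (w : Fin N → Fin N → ℝ) (v : Fin N → Load H) (n : Fin N) : Load H :=
  w n n • v n + ∑ k ∈ M.neighborFinset n, w n k • v k

/-- `q t n` and `v t n`, for `t = 1, 2, …`, are the consumption profiles and the estimates of the
average consumption that the synchronous agreement-based algorithm generates with weights `w`
and step sizes `α`. The values at `t = 0` play no role. -/
structure IsAgreementRun {N H : ℕ} (g : Game N H) (M : SimpleGraph (Fin N)) [DecidableRel M.Adj]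
    (w : Fin N → Fin N → ℝ) (α : ℕ → ℝ) (q v : ℕ → Fin N → Load H) : Prop where
  start_feasible : ∀ n, q 1 n ∈ g.feasible n
  start_estimate : ∀ n, v 1 n = q 1 n
  step_profile : ∀ t, 1 ≤ t → ∀ n,
    IsProjection (g.feasible n)
      (q t n - α t • g.gradBill (q t n) ((N : ℝ) • mix M w (v t) n)) (q (t + 1) n)
  step_estimate : ∀ t, 1 ≤ t → ∀ n,
    v (t + 1) n = mix M w (v t) n + q (t + 1) n - q t n

end DSM

/-! Nash equilibria are the solutions of the variational inequality of the joint gradient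
`jointGrad` on the compact convex set of feasible joint profiles (`isNash_iff_joint`), because each
bill is convex enough in the own profile. Two ingredients remain.

Strict monotonicity. The joint gradient splits over the slots. Along a segment with direction `z`
and current loads `x`, the derivative of its pairing with `z` is, in one slot, a positive multiple
of `(b-1) (∑ x_i z_i) σ + S |z|² + S σ²`, with `σ = ∑ z_i` and `S = ∑ x_i`. This is linear in `x ≥
0`, so it suffices to take `x` a unit vector. Cauchy-Schwarz on the other `N-1` coordinates then
leaves a binary quadratic form in `(z_i, σ)`, which is positive definite for `b < 3 + 4/(N-1)`
(`jacobian_vertex_pos`, `marginal_strictMonotone`).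

Consensus. Double stochasticity keeps the mean of the estimates equal to the mean of the profiles,
and averaging contracts deviations from the mean (`exists_averaging_contraction`). As `α → 0`, the
profiles move less and less, so the estimates agree in the limit and the gradients used differ from
the true ones by a vanishing error (`tendsto_consensus_perturbation`).

The algorithm is thus a projected method for a strictly monotone variational inequality with
vanishing errors. Its `α`-weighted averages accumulate at a solution, which gives existence, and the
iterates themselves then converge to it (`exists_tendsto_of_strictMonotone`). -/

/-! ### Perturbed projection methods for monotone variational inequalities. -/

section VariationalInequality

variable {X : Type*} [NormedAddCommGroup X] [InnerProductSpace ℝ X]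

/-- A Minty solution of a variational inequality with a continuous map is a Stampacchia solution. -/
theorem inner_nonneg_of_minty {K : Set X} (hK : Convex ℝ K) {F : X → X} (hF : ContinuousOn F K)
    {x : X} (hx : x ∈ K) (hm : ∀ y ∈ K, inner ℝ (F y) (x - y) ≤ 0) :
    ∀ y ∈ K, 0 ≤ inner ℝ (F x) (y - x) := by
  intro y hy
  -- Minty's trick: test at `x + θ • (y - x)`, divide by `θ > 0` and let `θ → 0`.
  have hmem : ∀ θ ∈ Set.Ioc (0 : ℝ) 1, x + θ • (y - x) ∈ K := fun θ hθ =>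
    hK.add_smul_sub_mem hx hy ⟨hθ.1.le, hθ.2⟩
  have hIoc : Set.Ioc (0 : ℝ) 1 ∈ 𝓝[>] (0 : ℝ) := Ioc_mem_nhdsGT one_pos
  have hline : Tendsto (fun θ : ℝ => x + θ • (y - x)) (𝓝[>] 0) (𝓝[K] x) := by
    refine tendsto_nhdsWithin_iff.2 ⟨?_, ?_⟩
    · have : Continuous (fun θ : ℝ => x + θ • (y - x)) := by fun_prop
      have h := this.tendsto 0
      simp only [zero_smul, add_zero] at h
      exact h.mono_left nhdsWithin_le_nhds
    · filter_upwards [hIoc] with θ hθ using hmem θ hθ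
  have hlim : Tendsto (fun θ : ℝ => inner ℝ (F (x + θ • (y - x))) (y - x)) (𝓝[>] 0)
      (𝓝 (inner ℝ (F x) (y - x))) :=
    Tendsto.inner ((hF x hx).tendsto.comp hline) tendsto_const_nhds
  refine ge_of_tendsto hlim ?_
  filter_upwards [hIoc] with θ hθ
  have h := hm _ (hmem θ hθ)
  rw [show x - (x + θ • (y - x)) = -(θ • (y - x)) by abel, inner_neg_right,
    real_inner_smul_right] at h
  have h' : 0 ≤ θ * inner ℝ (F (x + θ • (y - x))) (y - x) := by linarith
  exact nonneg_of_mul_nonneg_right h' hθ.1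

/-- The weighted averages of an approximate descent sequence of a monotone map accumulate at a
Minty solution. -/
theorem exists_minty_of_descent {K : Set X} (hK : IsCompact K) (hKc : Convex ℝ K) {F : X → X}
    (hmono : ∀ x ∈ K, ∀ y ∈ K, 0 ≤ inner ℝ (F x - F y) (x - y))
    {x : ℕ → X} (hx : ∀ t, x t ∈ K) {α ε : ℕ → ℝ} (hα : ∀ t, 0 ≤ α t)
    (hα_div : Tendsto (fun T => ∑ t ∈ Finset.range T, α t) atTop atTop)
    (hε : Tendsto ε atTop (𝓝 0))
    (hstep : ∀ t, ∀ y ∈ K, ‖x (t + 1) - y‖ ^ 2 ≤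
      ‖x t - y‖ ^ 2 - 2 * α t * inner ℝ (F (x t)) (x t - y) + α t * ε t) :
    ∃ z ∈ K, ∀ y ∈ K, inner ℝ (F y) (z - y) ≤ 0 := by
  set S : ℕ → ℝ := fun T => ∑ t ∈ Finset.range T, α t with hS
  set m : ℕ → X := fun T => (Finset.range T).centerMass α x with hm
  have hSpos : ∀ᶠ T in atTop, 0 < S T := hα_div.eventually_gt_atTop 0
  have hmK : ∀ᶠ T in atTop, m T ∈ K := by
    filter_upwards [hSpos] with T hT
    exact hKc.centerMass_mem (fun t _ => hα t) hT fun t _ => hx t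
  obtain ⟨z, hz, φ, hφ, hlim⟩ := hK.tendsto_subseq' hmK.frequently
  refine ⟨z, hz, fun y hy => ?_⟩
  -- Telescope the descent inequality. Monotonicity replaces `F (x t)` by the fixed `F y`, so the
  -- pairing becomes affine in `x t` and passes to the average `m T`.
  have hsum : ∀ T, 2 * ∑ t ∈ Finset.range T, α t * inner ℝ (F y) (x t - y) ≤
      ‖x 0 - y‖ ^ 2 + ∑ t ∈ Finset.range T, α t * ε t := by
    intro T
    have key : ∀ T, ‖x T - y‖ ^ 2 + 2 * ∑ t ∈ Finset.range T, α t * inner ℝ (F y) (x t - y) ≤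
        ‖x 0 - y‖ ^ 2 + ∑ t ∈ Finset.range T, α t * ε t := by
      intro T
      induction T with
      | zero => simp
      | succ T ih =>
        rw [Finset.sum_range_succ, Finset.sum_range_succ]
        have h1 := hstep T y hy
        have h2 := hmono (x T) (hx T) y hy
        rw [inner_sub_left] at h2
        have h3 := mul_le_mul_of_nonneg_left (sub_nonneg.1 h2) (hα T)
        linarith
    have := key T
    have h0 : 0 ≤ ‖x T - y‖ ^ 2 := by positivity
    linarith
  have havg : ∀ᶠ T in atTop, 2 * inner ℝ (F y) (m T - y) ≤
      (‖x 0 - y‖ ^ 2) / S T + (∑ t ∈ Finset.range T, α t * ε t) / S T := by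
    filter_upwards [hSpos] with T hT
    have hin : inner ℝ (F y) (m T - y) =
        (∑ t ∈ Finset.range T, α t * inner ℝ (F y) (x t - y)) / S T := by
      have h1 : ∑ t ∈ Finset.range T, α t * inner ℝ (F y) (x t - y) =
          inner ℝ (F y) (∑ t ∈ Finset.range T, α t • x t) - S T * inner ℝ (F y) y := by
        simp only [inner_sub_right, mul_sub, Finset.sum_sub_distrib, inner_sum,
          real_inner_smul_right, ← Finset.sum_mul, hS]
      rw [h1, hm]
      simp only [Finset.centerMass, inner_sub_right, real_inner_smul_right]
      change (S T)⁻¹ * _ - _ = _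
      field_simp
    rw [hin, ← add_div, ← mul_div_assoc]
    exact div_le_div_of_nonneg_right (hsum T) hT.le
  have hr1 : Tendsto (fun T => (‖x 0 - y‖ ^ 2) / S T) atTop (𝓝 0) :=
    tendsto_const_nhds.div_atTop hα_div
  have hr2 : Tendsto (fun T => (∑ t ∈ Finset.range T, α t * ε t) / S T) atTop (𝓝 0) := by
    have ho : (fun t => α t * ε t) =o[atTop] α := by
      have := (Asymptotics.isBigO_refl α atTop).mul_isLittleO
        ((Asymptotics.isLittleO_one_iff ℝ).2 hε)
      simpa using this
    exact (ho.sum_range hα hα_div).tendsto_div_nhds_zero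
  have hr := hr1.add hr2
  rw [add_zero] at hr
  have hl : Tendsto (fun k => 2 * inner ℝ (F y) (m (φ k) - y)) atTop
      (𝓝 (2 * inner ℝ (F y) (z - y))) :=
    (Tendsto.inner tendsto_const_nhds (hlim.sub_const y)).const_mul 2
  have := le_of_tendsto_of_tendsto hl (hr.comp hφ.tendsto_atTop)
    (hφ.tendsto_atTop.eventually havg)
  linarith

/-- A descent sequence of a map that is positive relative to `z` converges to `z`. -/
theorem tendsto_of_descent {K : Set X} (hK : IsCompact K) {F : X → X} (hF : ContinuousOn F K)
    {z : X} (hpos : ∀ x ∈ K, x ≠ z → 0 < inner ℝ (F x) (x - z))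
    {x : ℕ → X} (hx : ∀ t, x t ∈ K) {α ε : ℕ → ℝ} (hα : ∀ t, 0 ≤ α t)
    (hα_div : Tendsto (fun T => ∑ t ∈ Finset.range T, α t) atTop atTop)
    (hα0 : Tendsto α atTop (𝓝 0)) (hε : Tendsto ε atTop (𝓝 0))
    (hstep : ∀ t, ‖x (t + 1) - z‖ ^ 2 ≤
      ‖x t - z‖ ^ 2 - 2 * α t * inner ℝ (F (x t)) (x t - z) + α t * ε t) :
    Tendsto x atTop (𝓝 z) := by
  have hnonneg : ∀ y ∈ K, 0 ≤ inner ℝ (F y) (y - z) := by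
    intro y hy
    rcases eq_or_ne y z with rfl | h
    · simp
    · exact (hpos y hy h).le
  suffices h : ∀ η > 0, ∀ᶠ t in atTop, ‖x t - z‖ ^ 2 ≤ 2 * η by
    rw [tendsto_iff_norm_sub_tendsto_zero]
    have hsq : Tendsto (fun t => ‖x t - z‖ ^ 2) atTop (𝓝 0) := by
      rw [Metric.tendsto_nhds]
      intro e he
      filter_upwards [h (e / 4) (by positivity)] with t ht
      rw [Real.dist_eq, sub_zero, abs_of_nonneg (by positivity)]
      linarith
    have := hsq.sqrt
    simpa [Real.sqrt_sq] using this
  intro η hη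
  -- Outside the `η`-level the pairing has a positive minimum `δ` by compactness. Once `ε ≤ δ` and
  -- `α ε ≤ η`, every step from there lowers the squared distance by at least `α δ`. Divergence of
  -- the sum of `α` forces a visit below `η`, and a step from below `η` ends below `2 * η`.
  obtain ⟨δ, hδ, hδK⟩ : ∃ δ > 0, ∀ y ∈ K, η ≤ ‖y - z‖ ^ 2 → δ ≤ inner ℝ (F y) (y - z) := by
    have hC : IsCompact (K ∩ {y | η ≤ ‖y - z‖ ^ 2}) :=
      hK.inter_right (isClosed_le continuous_const (by fun_prop))
    rcases (K ∩ {y | η ≤ ‖y - z‖ ^ 2}).eq_empty_or_nonempty with he | hne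
    · refine ⟨1, one_pos, fun y hy h => ?_⟩
      have : y ∈ K ∩ {y | η ≤ ‖y - z‖ ^ 2} := ⟨hy, h⟩
      rw [he] at this
      exact this.elim
    · have hc : ContinuousOn (fun y => inner ℝ (F y) (y - z)) (K ∩ {y | η ≤ ‖y - z‖ ^ 2}) :=
        (hF.mono Set.inter_subset_left).inner (by fun_prop)
      obtain ⟨u, hu, humin⟩ := hC.exists_isMinOn hne hc
      refine ⟨_, hpos u hu.1 ?_, fun y hy h => humin ⟨hy, h⟩⟩
      rintro rfl
      have := hu.2
      simp only [Set.mem_ofPred_eq, sub_self, norm_zero] at this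
      norm_num at this
      linarith
  have hαε : Tendsto (fun t => α t * ε t) atTop (𝓝 0) := by simpa using hα0.mul hε
  obtain ⟨T, hT⟩ := eventually_atTop.1
    ((hε.eventually_le_const hδ).and (hαε.eventually_le_const hη))
  have hdec : ∀ t ≥ T, η ≤ ‖x t - z‖ ^ 2 → ‖x (t + 1) - z‖ ^ 2 ≤ ‖x t - z‖ ^ 2 - α t * δ := by
    intro t ht h
    have h1 := mul_le_mul_of_nonneg_left (hδK (x t) (hx t) h) (hα t)
    have h2 := mul_le_mul_of_nonneg_left (hT t ht).1 (hα t)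
    linarith [hstep t]
  obtain ⟨s, hs, hsη⟩ : ∃ s ≥ T, ‖x s - z‖ ^ 2 < η := by
    by_contra! hcon
    have hsum : ∀ k, ‖x (T + k) - z‖ ^ 2 +
        (∑ t ∈ Finset.range (T + k), α t - ∑ t ∈ Finset.range T, α t) * δ ≤ ‖x T - z‖ ^ 2 := by
      intro k
      induction k with
      | zero => simp
      | succ k ih =>
        have := hdec (T + k) (by omega) (hcon (T + k) (by omega))
        rw [← add_assoc, Finset.sum_range_succ]
        linarith
    have hev := hα_div.eventually_gt_atTop
      (∑ t ∈ Finset.range T, α t + ‖x T - z‖ ^ 2 / δ)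
    obtain ⟨r, hr, hrT⟩ := (hev.and (eventually_ge_atTop T)).exists
    obtain ⟨k, rfl⟩ := Nat.exists_eq_add_of_le hrT
    have h1 := hsum k
    have h2 : ‖x T - z‖ ^ 2 / δ <
      ∑ t ∈ Finset.range (T + k), α t - ∑ t ∈ Finset.range T, α t := by linarith
    rw [div_lt_iff₀ hδ] at h2
    have h3 : 0 ≤ ‖x (T + k) - z‖ ^ 2 := by positivity
    linarith
  filter_upwards [eventually_ge_atTop s] with t ht
  induction t, ht using Nat.le_induction with
  | base => linarith
  | succ t ht ih =>
    rcases lt_or_ge (‖x t - z‖ ^ 2) η with h | h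
    · have h1 := mul_nonneg (hα t) (hnonneg (x t) (hx t))
      linarith [hstep t, (hT t (hs.trans ht)).2]
    · have h1 := mul_nonneg (hα t) hδ.le
      linarith [hdec t (hs.trans ht) h]

/-- A projected descent method with vanishing perturbations for a strictly monotone variational
inequality converges to a solution. -/
theorem exists_tendsto_of_strictMonotone {K : Set X} (hK : IsCompact K) (hKc : Convex ℝ K)
    {F : X → X} (hF : ContinuousOn F K)
    (hmono : ∀ x ∈ K, ∀ y ∈ K, x ≠ y → 0 < inner ℝ (F x - F y) (x - y))
    {x G : ℕ → X} (hx : ∀ t, x t ∈ K) {α : ℕ → ℝ} (hα : ∀ t, 0 ≤ α t)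
    (hα_div : Tendsto (fun T => ∑ t ∈ Finset.range T, α t) atTop atTop)
    (hα0 : Tendsto α atTop (𝓝 0))
    (hG : Tendsto (fun t => G t - F (x t)) atTop (𝓝 0))
    (hstep : ∀ t, ∀ y ∈ K, ‖x (t + 1) - y‖ ≤ ‖x t - α t • G t - y‖) :
    ∃ z ∈ K, (∀ y ∈ K, 0 ≤ inner ℝ (F z) (y - z)) ∧ Tendsto x atTop (𝓝 z) := by
  obtain ⟨D, hD⟩ := hK.exists_bound_of_continuousOn (f := id) continuousOn_id
  obtain ⟨C, hC⟩ := hK.exists_bound_of_continuousOn hF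
  simp only [id] at hD
  set e : ℕ → ℝ := fun t => ‖G t - F (x t)‖ with he
  have he0 : Tendsto e atTop (𝓝 0) := by simpa using hG.norm
  -- The first term bounds the cross term of the gradient error, as `K` has diameter at most `2 *
  -- D`; the second bounds the square of the step, divided by `α t`.
  set ε : ℕ → ℝ := fun t => 4 * D * e t + α t * (e t + C) ^ 2 with hε
  have hε0 : Tendsto ε atTop (𝓝 0) := by
    simpa using (he0.const_mul (4 * D)).add (hα0.mul ((he0.add_const C).pow 2))
  have hdesc : ∀ t, ∀ y ∈ K, ‖x (t + 1) - y‖ ^ 2 ≤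
      ‖x t - y‖ ^ 2 - 2 * α t * inner ℝ (F (x t)) (x t - y) + α t * ε t := by
    intro t y hy
    have h1 : ‖x (t + 1) - y‖ ^ 2 ≤ ‖x t - α t • G t - y‖ ^ 2 :=
      pow_le_pow_left₀ (norm_nonneg _) (hstep t y hy) 2
    have h2 : ‖x t - α t • G t - y‖ ^ 2 = ‖x t - y‖ ^ 2 -
        2 * α t * (inner ℝ (F (x t)) (x t - y) + inner ℝ (G t - F (x t)) (x t - y))
        + α t ^ 2 * ‖G t‖ ^ 2 := by
      rw [← inner_add_left, add_sub_cancel, show x t - α t • G t - y = (x t - y) - α t • G t by abel,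
        norm_sub_sq_real, real_inner_smul_right, norm_smul, mul_pow, Real.norm_eq_abs, sq_abs,
        real_inner_comm]
      ring
    have h3 : -(e t * (2 * D)) ≤ inner ℝ (G t - F (x t)) (x t - y) := by
      have ha := (abs_le.1 (abs_real_inner_le_norm (G t - F (x t)) (x t - y))).1
      have hb : ‖x t - y‖ ≤ 2 * D := by
        linarith [norm_sub_le (x t) y, hD _ (hx t), hD y hy]
      have := mul_le_mul_of_nonneg_left hb (norm_nonneg (G t - F (x t)))
      linarith
    have h4 : ‖G t‖ ^ 2 ≤ (e t + C) ^ 2 := by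
      refine pow_le_pow_left₀ (norm_nonneg _) ?_ 2
      have : ‖G t‖ ≤ ‖G t - F (x t)‖ + ‖F (x t)‖ := by
        simpa using norm_add_le (G t - F (x t)) (F (x t))
      linarith [hC _ (hx t)]
    have h5 := mul_le_mul_of_nonneg_left h3 (hα t)
    have h6 := mul_le_mul_of_nonneg_left h4 (sq_nonneg (α t))
    simp only [hε]
    nlinarith
  have hmono' : ∀ x ∈ K, ∀ y ∈ K, 0 ≤ inner ℝ (F x - F y) (x - y) := by
    intro x hx y hy
    rcases eq_or_ne x y with rfl | h
    · simp
    · exact (hmono x hx y hy h).le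
  obtain ⟨z, hz, hminty⟩ := exists_minty_of_descent hK hKc hmono' hx hα hα_div hε0 hdesc
  have hvi := inner_nonneg_of_minty hKc hF hz hminty
  refine ⟨z, hz, hvi, tendsto_of_descent hK hF ?_ hx hα hα_div hα0 hε0 fun t => hdesc t z hz⟩
  intro y hy hne
  have h := hmono y hy z hz hne
  rw [inner_sub_left] at h
  linarith [hvi y hy]

end VariationalInequality

/-! ### Graph averaging, consensus and vanishing gradient errors. -/

/-- If all `z k` with `k` adjacent to `n` are equal to `u n`, for every `n`, then `z` is constant,
provided that the graph is connected and not bipartite, or `z` and `u` agree somewhere. -/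
theorem eq_of_forall_adj_eq {V S : Type*} {M : SimpleGraph V} (hM : M.Connected)
    {z u : V → S} (hadj : ∀ n k, M.Adj n k → z k = u n)
    (hself : M.IsBipartite → ∃ n, z n = u n) (i j : V) : z i = z j := by
  -- Crossing an edge swaps the values of `z` and `u`.
  have hwalk : ∀ k, (z k = z i ∧ u k = u i) ∨ (z k = u i ∧ u k = z i) := by
    intro k
    obtain ⟨p⟩ := hM.preconnected k i
    induction p with
    | nil => exact Or.inl ⟨rfl, rfl⟩
    | cons h p ih =>
      have h1 := hadj _ _ h
      have h2 := hadj _ _ h.symm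
      rcases ih with ⟨h3, h4⟩ | ⟨h3, h4⟩
      · exact Or.inr ⟨h2.trans h4, h1.symm.trans h3⟩
      · exact Or.inl ⟨h2.trans h4, h1.symm.trans h3⟩
  -- If `z i ≠ u i`, the swapping is a proper 2-colouring, so the graph is bipartite; a vertex with
  -- `z n = u n` then contradicts `hwalk`.
  have hii : z i = u i := by
    by_contra hne
    have hbip : M.IsBipartite := by
      classical
      let c : M.Coloring Bool := SimpleGraph.Coloring.mk (fun n => decide (z n = z i)) (by
        intro n k h heq
        have h1 := hadj _ _ h
        have hiff : z n = z i ↔ z k = z i := by simpa using heq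
        rcases hwalk n with ⟨h3, h4⟩ | ⟨h3, h4⟩
        · exact hne ((hiff.1 h3).symm.trans (h1.trans h4))
        · exact hne ((hiff.2 (h1.trans h4)).symm.trans h3))
      simpa using c.colorable
    obtain ⟨n, hn⟩ := hself hbip
    rcases hwalk n with ⟨h3, h4⟩ | ⟨h3, h4⟩
    · exact hne (h3.symm.trans (hn.trans h4))
    · exact hne (h4.symm.trans (hn.symm.trans h3))
  rcases hwalk j with ⟨h, -⟩ | ⟨h, -⟩
  · exact h.symm
  · exact hii.trans h.symm

/-- Perturbations of an argument that vanish do so uniformly over a compact set. -/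
theorem tendsto_sub_of_perturbation {X Y Z : Type*} [NormedAddCommGroup X] [NormedAddCommGroup Y]
    [ProperSpace Y] [NormedAddCommGroup Z] {f : X × Y → Z} (hf : Continuous f) {K : Set X}
    (hK : IsCompact K) {x : ℕ → X} (hx : ∀ t, x t ∈ K) {d : ℕ → Y} {R : ℝ}
    (hR : ∀ t, ‖d t‖ ≤ R) (hd : Tendsto d atTop (𝓝 0)) :
    Tendsto (fun t => f (x t, d t) - f (x t, 0)) atTop (𝓝 0) := by
  have hR0 : 0 ≤ R := (norm_nonneg _).trans (hR 0)
  have hu := (hK.prod (isCompact_closedBall (0 : Y) R)).uniformContinuousOn_of_continuous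
    hf.continuousOn
  rw [Metric.uniformContinuousOn_iff] at hu
  rw [Metric.tendsto_atTop]
  intro e he
  obtain ⟨δ, hδ, h⟩ := hu e he
  obtain ⟨T, hT⟩ := Metric.tendsto_atTop.1 hd δ hδ
  refine ⟨T, fun t ht => ?_⟩
  rw [dist_zero_right, ← dist_eq_norm]
  refine h _ ⟨hx t, by simpa using hR t⟩ _ ⟨hx t, by simpa using hR0⟩ ?_
  rw [Prod.dist_eq, dist_self]
  exact max_lt hδ (hT t ht)

section Consensus

variable {ι : Type*} [Fintype ι] {E : Type*} [NormedAddCommGroup E] [InnerProductSpace ℝ E]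

/-- The variance identity for a convex combination. -/
theorem sum_mul_norm_sub_sq {p : ι → ℝ} (hp : ∑ k, p k = 1) (z : ι → E) :
    ∑ k, p k * ‖z k - ∑ j, p j • z j‖ ^ 2 = ∑ k, p k * ‖z k‖ ^ 2 - ‖∑ j, p j • z j‖ ^ 2 := by
  set m := ∑ j, p j • z j with hm
  have h1 : ∑ k, p k * inner ℝ (z k) m = ‖m‖ ^ 2 := by
    rw [← real_inner_self_eq_norm_sq, hm, sum_inner]
    simp only [real_inner_smul_left]
  simp only [norm_sub_sq_real, mul_add, mul_sub, Finset.sum_add_distrib, Finset.sum_sub_distrib,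
    ← Finset.sum_mul, hp]
  have h2 : ∑ k, p k * (2 * inner ℝ (z k) m) = 2 * ∑ k, p k * inner ℝ (z k) m := by
    rw [Finset.mul_sum]
    exact Finset.sum_congr rfl fun k _ => by ring
  rw [h2, h1]
  ring

/-- The dissipation identity for a doubly stochastic matrix. -/
theorem sum_norm_sq_averaging {w : ι → ι → ℝ} (hrow : ∀ n, ∑ k, w n k = 1)
    (hcol : ∀ k, ∑ n, w n k = 1) (z : ι → E) :
    ∑ n, ‖∑ k, w n k • z k‖ ^ 2 + ∑ n, ∑ k, w n k * ‖z k - ∑ j, w n j • z j‖ ^ 2 =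
      ∑ k, ‖z k‖ ^ 2 := by
  simp only [sum_mul_norm_sub_sq (hrow _), Finset.sum_sub_distrib]
  rw [Finset.sum_comm (f := fun n k => w n k * ‖z k‖ ^ 2)]
  simp only [← Finset.sum_mul, hcol, one_mul]
  ring

/-- Averaging with the weights `w`, as a linear map on tuples with the Euclidean norm. -/
noncomputable def averaging (E : Type*) [NormedAddCommGroup E] [InnerProductSpace ℝ E]
    (w : ι → ι → ℝ) : PiLp 2 (fun _ : ι => E) →ₗ[ℝ] PiLp 2 (fun _ : ι => E) where
  toFun z := WithLp.toLp 2 fun n => ∑ k, w n k • z k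
  map_add' x y := by
    ext n
    simp [Finset.sum_add_distrib]
  map_smul' r x := by
    ext n
    simp [Finset.smul_sum, smul_comm r]

@[simp]
theorem averaging_apply (w : ι → ι → ℝ) (z : PiLp 2 (fun _ : ι => E)) (n : ι) :
    averaging E w z n = ∑ k, w n k • z k := rfl

/-- The deviation of a tuple from its mean. -/
noncomputable def deviation (ι E : Type*) [Fintype ι] [NormedAddCommGroup E]
    [InnerProductSpace ℝ E] : PiLp 2 (fun _ : ι => E) →ₗ[ℝ] PiLp 2 (fun _ : ι => E) :=
  LinearMap.id - averaging E fun _ _ => (Fintype.card ι : ℝ)⁻¹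

@[simp]
theorem deviation_apply (z : PiLp 2 (fun _ : ι => E)) (n : ι) :
    deviation ι E z n = z n - (Fintype.card ι : ℝ)⁻¹ • ∑ k, z k := by
  simp [deviation, Finset.smul_sum]

theorem sum_deviation [Nonempty ι] (z : PiLp 2 (fun _ : ι => E)) :
    ∑ n, deviation ι E z n = 0 := by
  have : (Fintype.card ι : ℝ) ≠ 0 := by simp
  simp only [deviation_apply, Finset.sum_sub_distrib, Finset.sum_const, Finset.card_univ,
    ← Nat.cast_smul_eq_nsmul ℝ, smul_smul, mul_inv_cancel₀ this, one_smul, sub_self]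

theorem sum_averaging {w : ι → ι → ℝ} (hcol : ∀ k, ∑ n, w n k = 1)
    (z : PiLp 2 (fun _ : ι => E)) : ∑ n, averaging E w z n = ∑ n, z n := by
  simp only [averaging_apply]
  rw [Finset.sum_comm]
  simp only [← Finset.sum_smul, hcol, one_smul]

/-- Unit column sums preserve the mean and unit row sums fix constant tuples. This turns the
recursion of the estimates into one for their deviations. -/
theorem deviation_averaging {w : ι → ι → ℝ} (hrow : ∀ n, ∑ k, w n k = 1)
    (hcol : ∀ k, ∑ n, w n k = 1) (z : PiLp 2 (fun _ : ι => E)) :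
    deviation ι E (averaging E w z) = averaging E w (deviation ι E z) := by
  ext1 n
  rw [deviation_apply, sum_averaging hcol]
  simp only [averaging_apply, deviation_apply, smul_sub, Finset.sum_sub_distrib,
    ← Finset.sum_smul, hrow, one_smul]

/-- Averaging over a connected graph contracts the tuples with mean zero. -/
theorem exists_averaging_contraction [FiniteDimensional ℝ E] {M : SimpleGraph ι}
    (hM : M.Connected) {w : ι → ι → ℝ} (hnonneg : ∀ n k, 0 ≤ w n k)
    (hrow : ∀ n, ∑ k, w n k = 1) (hcol : ∀ k, ∑ n, w n k = 1)
    (hedge : ∀ n k, M.Adj n k → 0 < w n k) (hself : M.IsBipartite → ∃ n, 0 < w n n) :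
    ∃ ρ : ℝ, 0 ≤ ρ ∧ ρ < 1 ∧ ∀ z : PiLp 2 (fun _ : ι => E), ∑ n, z n = 0 →
      ‖averaging E w z‖ ≤ ρ * ‖z‖ := by
  have : Nonempty ι := hM.nonempty
  have hlt : ∀ z : PiLp 2 (fun _ : ι => E), ∑ n, z n = 0 → z ≠ 0 →
      ‖averaging E w z‖ < ‖z‖ := by
    intro z hz hne
    refine lt_of_pow_lt_pow_left₀ 2 (norm_nonneg _) ?_
    rw [PiLp.norm_sq_eq_of_L2, PiLp.norm_sq_eq_of_L2]
    have hdis := sum_norm_sq_averaging hrow hcol (fun k => z k)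
    simp only [averaging_apply]
    have hterm : ∀ n k, 0 ≤ w n k * ‖z k - ∑ j, w n j • z j‖ ^ 2 := fun n k =>
      mul_nonneg (hnonneg n k) (by positivity)
    have hrest : 0 ≤ ∑ n, ∑ k, w n k * ‖z k - ∑ j, w n j • z j‖ ^ 2 :=
      Finset.sum_nonneg fun n _ => Finset.sum_nonneg fun k _ => hterm n k
    rcases hrest.lt_or_eq with h | h
    · linarith
    -- Without dissipation, `z k` equals the average at `n` whenever `w n k > 0`; this forces `z` to
    -- be constant, hence zero.
    · exfalso
      have h0 : ∀ n k, 0 < w n k → z k = ∑ j, w n j • z j := by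
        intro n k hnk
        have h1 := (Finset.sum_eq_zero_iff_of_nonneg fun n _ =>
          Finset.sum_nonneg fun k _ => hterm n k).1 h.symm n (Finset.mem_univ n)
        have h2 := (Finset.sum_eq_zero_iff_of_nonneg fun k _ => hterm n k).1 h1 k
          (Finset.mem_univ k)
        have h3 := (mul_eq_zero.1 h2).resolve_left hnk.ne'
        exact sub_eq_zero.1 (norm_eq_zero.1 (pow_eq_zero_iff two_ne_zero |>.1 h3))
      have hconst := eq_of_forall_adj_eq hM (z := fun k => z k)
        (u := fun n => ∑ j, w n j • z j) (fun n k h => h0 n k (hedge n k h))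
        (fun hb => (hself hb).imp fun n hn => h0 n n hn)
      refine hne ?_
      ext1 n
      have : ∑ k, z k = (Fintype.card ι : ℝ) • z n := by
        rw [Finset.sum_congr rfl fun k _ => hconst k n, Finset.sum_const, Finset.card_univ,
          Nat.cast_smul_eq_nsmul]
      rw [this] at hz
      simpa using hz
  have hcont : Continuous (averaging E w) := LinearMap.continuous_of_finiteDimensional _
  set S : Set (PiLp 2 (fun _ : ι => E)) := Metric.sphere 0 1 ∩ {z | ∑ n, z n = 0} with hS
  have hSc : IsCompact S :=
    (isCompact_sphere _ _).inter_right (isClosed_eq (by fun_prop) continuous_const)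
  obtain ⟨ρ, hρ0, hρ1, hρ⟩ : ∃ ρ : ℝ, 0 ≤ ρ ∧ ρ < 1 ∧ ∀ z ∈ S, ‖averaging E w z‖ ≤ ρ := by
    -- `S` is empty if `E` is trivial or `ι` has a single element.
    rcases S.eq_empty_or_nonempty with he | hne
    · exact ⟨0, le_rfl, one_pos, fun z hz => by simp [he] at hz⟩
    · obtain ⟨u, hu, hmax⟩ := hSc.exists_isMaxOn hne hcont.norm.continuousOn
      have hu1 : ‖u‖ = 1 := by simpa using hu.1
      refine ⟨‖averaging E w u‖, norm_nonneg _, ?_, fun z hz => hmax hz⟩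
      have := hlt u hu.2 (by rintro rfl; simp at hu1)
      rwa [hu1] at this
  refine ⟨ρ, hρ0, hρ1, fun z hz => ?_⟩
  rcases eq_or_ne z 0 with rfl | hne
  · simp
  · have hn : ‖z‖ ≠ 0 := norm_ne_zero_iff.2 hne
    have hmem : ‖z‖⁻¹ • z ∈ S := by
      refine ⟨by simp [norm_smul, hn], ?_⟩
      change ∑ n, ‖z‖⁻¹ • z n = 0
      rw [← Finset.smul_sum, hz, smul_zero]
    have := hρ _ hmem
    rw [map_smul, norm_smul, norm_inv, norm_norm, inv_mul_le_iff₀ (by positivity)] at this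
    linarith

/-- A perturbed contraction stays bounded. -/
theorem bounded_of_le_mul_add {r β : ℕ → ℝ} {ρ B : ℝ} (hρ0 : 0 ≤ ρ) (hρ1 : ρ < 1)
    (h : ∀ t, r (t + 1) ≤ ρ * r t + β t) (hβ : ∀ t, β t ≤ B) :
    ∃ R, ∀ t, r t ≤ R := by
  -- `B / (1 - ρ)` is the fixed point of `s ↦ ρ * s + B`.
  refine ⟨max (r 0) (B / (1 - ρ)), fun t => ?_⟩
  have h1 : 0 < 1 - ρ := by linarith
  induction t with
  | zero => exact le_max_left _ _
  | succ t ih =>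
    have h2 := mul_le_mul_of_nonneg_left ih hρ0
    have h3 := le_max_right (r 0) (B / (1 - ρ))
    rw [div_le_iff₀ h1] at h3
    linarith [h t, hβ t]

/-- A contraction with vanishing perturbations tends to zero. -/
theorem tendsto_zero_of_le_mul_add {r β : ℕ → ℝ} {ρ : ℝ} (hρ0 : 0 ≤ ρ) (hρ1 : ρ < 1)
    (hr : ∀ t, 0 ≤ r t) (h : ∀ t, r (t + 1) ≤ ρ * r t + β t)
    (hβ : Tendsto β atTop (𝓝 0)) : Tendsto r atTop (𝓝 0) := by
  have h1 : 0 < 1 - ρ := by linarith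
  rw [Metric.tendsto_atTop]
  intro e he
  -- Perturbations of this size have the fixed point `e / 2`.
  obtain ⟨T, hT⟩ := eventually_atTop.1
    (hβ.eventually_le_const (show 0 < e / 2 * (1 - ρ) by positivity))
  have hk : ∀ k, r (T + k) ≤ e / 2 + ρ ^ k * r T := by
    intro k
    induction k with
    | zero => simp; positivity
    | succ k ih =>
      have h2 := mul_le_mul_of_nonneg_left ih hρ0
      have h3 := hT (T + k) (by omega)
      have h4 := h (T + k)
      rw [← add_assoc, pow_succ]
      linarith
  have hp : Tendsto (fun k => ρ ^ k * r T) atTop (𝓝 0) := by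
    simpa using (tendsto_pow_atTop_nhds_zero_of_lt_one hρ0 hρ1).mul_const (r T)
  obtain ⟨k0, hk0⟩ := eventually_atTop.1 (hp.eventually_lt_const (half_pos he))
  refine ⟨T + k0, fun t ht => ?_⟩
  obtain ⟨k, rfl⟩ := Nat.exists_eq_add_of_le (show T ≤ t by omega)
  rw [Real.dist_eq, sub_zero, abs_of_nonneg (hr _)]
  linarith [hk k, hk0 k (by omega)]

theorem continuous_deviation [FiniteDimensional ℝ E] : Continuous (deviation ι E) :=
  LinearMap.continuous_of_finiteDimensional _

/-- In a gradient method whose gradients depend on estimates that follow a consensus protocol,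
the error of the gradients vanishes. -/
theorem tendsto_consensus_perturbation [FiniteDimensional ℝ E] [Nonempty ι]
    {f : PiLp 2 (fun _ : ι => E) × PiLp 2 (fun _ : ι => E) → PiLp 2 (fun _ : ι => E)}
    (hf : Continuous f) {K : Set (PiLp 2 (fun _ : ι => E))} (hK : IsCompact K)
    {x V d : ℕ → PiLp 2 (fun _ : ι => E)} (hx : ∀ t, x t ∈ K)
    {w : ι → ι → ℝ} (hrow : ∀ n, ∑ k, w n k = 1) (hcol : ∀ k, ∑ n, w n k = 1)
    {ρ : ℝ} (hρ0 : 0 ≤ ρ) (hρ1 : ρ < 1)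
    (hρ : ∀ z : PiLp 2 (fun _ : ι => E), ∑ n, z n = 0 → ‖averaging E w z‖ ≤ ρ * ‖z‖)
    (hV : ∀ t, V (t + 1) = averaging E w (V t) + (x (t + 1) - x t)) {c : ℝ} (hc : 0 ≤ c)
    (hd : ∀ t, d t = c • averaging E w (deviation ι E (V t)))
    {α : ℕ → ℝ} (hα : ∀ t, 0 ≤ α t) (hα0 : Tendsto α atTop (𝓝 0))
    (hmove : ∀ t, ‖x (t + 1) - x t‖ ≤ α t * ‖f (x t, d t)‖) :
    Tendsto (fun t => f (x t, d t) - f (x t, 0)) atTop (𝓝 0) := by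
  set D := deviation ι E with hD
  set W := averaging E w with hW
  have hDc : Continuous D := continuous_deviation
  set r : ℕ → ℝ := fun t => ‖D (V t)‖ with hr
  set β : ℕ → ℝ := fun t => ‖D (x (t + 1) - x t)‖ with hβ
  have hWD : ∀ t, ‖W (D (V t))‖ ≤ ρ * r t := fun t => hρ _ (sum_deviation _)
  have hrec : ∀ t, r (t + 1) ≤ ρ * r t + β t := by
    intro t
    have h1 : D (V (t + 1)) = W (D (V t)) + D (x (t + 1) - x t) := by
      rw [hV, map_add, hD, hW, deviation_averaging hrow hcol]
    calc r (t + 1) = ‖W (D (V t)) + D (x (t + 1) - x t)‖ := by rw [hr]; simp only [h1]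
      _ ≤ ‖W (D (V t))‖ + β t := norm_add_le _ _
      _ ≤ ρ * r t + β t := by linarith [hWD t]
  have hdr : ∀ t, ‖d t‖ ≤ c * (ρ * r t) := by
    intro t
    rw [hd, norm_smul, Real.norm_of_nonneg hc]
    exact mul_le_mul_of_nonneg_left (hWD t) hc
  obtain ⟨B, hB⟩ := hK.exists_bound_of_continuousOn
    hDc.continuousOn
  -- Bootstrap: compactness of `K` alone bounds the deviations, hence the gradients; then `α → 0`
  -- makes the moves vanish, and with them the deviations.
  obtain ⟨R, hR⟩ := bounded_of_le_mul_add (B := 2 * B) hρ0 hρ1 hrec fun t => by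
    have h1 : β t ≤ ‖D (x (t + 1))‖ + ‖D (x t)‖ := by
      simp only [hβ, map_sub]
      exact norm_sub_le _ _
    linarith [hB _ (hx (t + 1)), hB _ (hx t)]
  have hdR : ∀ t, ‖d t‖ ≤ c * (ρ * R) := fun t => (hdr t).trans
    (mul_le_mul_of_nonneg_left (mul_le_mul_of_nonneg_left (hR t) hρ0) hc)
  obtain ⟨C, hC⟩ := (hK.prod
    (isCompact_closedBall (0 : PiLp 2 (fun _ : ι => E)) (c * (ρ * R)))
    ).exists_bound_of_continuousOn hf.continuousOn
  have hGC : ∀ t, ‖f (x t, d t)‖ ≤ C := fun t =>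
    hC _ ⟨hx t, by simpa using hdR t⟩
  have hdx : Tendsto (fun t => x (t + 1) - x t) atTop (𝓝 0) := by
    refine squeeze_zero_norm (fun t => (hmove t).trans
      (mul_le_mul_of_nonneg_left (hGC t) (hα t))) ?_
    simpa using hα0.mul_const C
  have hβ0 : Tendsto β atTop (𝓝 0) := by
    simpa [hβ] using ((hDc.tendsto 0).comp hdx).norm
  have hr0 := tendsto_zero_of_le_mul_add hρ0 hρ1 (fun t => norm_nonneg (D (V t))) hrec hβ0
  have hd0 : Tendsto d atTop (𝓝 0) := by
    refine squeeze_zero_norm hdr ?_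
    simpa using (hr0.const_mul ρ).const_mul c
  exact tendsto_sub_of_perturbation hf hK hx hdR hd0

end Consensus

/-! ### Strict monotonicity of the marginal costs in one slot. -/

section Scalar

/-- The symmetrized Jacobian of the marginal costs at a unit load of a single consumer is
positive definite. -/
theorem jacobian_vertex_pos {ι : Type*} [Fintype ι] (hN : 2 ≤ Fintype.card ι) {β : ℝ}
    (hβ0 : 0 ≤ β) (hβ : β < 2 + 4 / ((Fintype.card ι : ℝ) - 1)) {z : ι → ℝ} (hz : z ≠ 0) (i : ι) :
    0 < β * z i * ∑ j, z j + ∑ j, z j ^ 2 + (∑ j, z j) ^ 2 := by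
  classical
  have hN' : (2 : ℝ) ≤ Fintype.card ι := by exact_mod_cast hN
  set K : ℝ := (Fintype.card ι : ℝ) - 1 with hK
  have hK1 : 1 ≤ K := by linarith
  set σ := ∑ j, z j with hσ
  set u := z i with hu
  have hβK : β * K < 2 * K + 4 := by
    have := mul_lt_mul_of_pos_right hβ (show 0 < K by linarith)
    rwa [add_mul, div_mul_cancel₀ _ (by linarith)] at this
  by_cases h0 : u = 0 ∧ σ = 0
  · rw [h0.1, h0.2]
    obtain ⟨j, hj⟩ := Function.ne_iff.1 hz
    have : 0 < ∑ j, z j ^ 2 := Finset.sum_pos' (fun j _ => sq_nonneg _)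
      ⟨j, Finset.mem_univ j, by have : z j ≠ 0 := hj; positivity⟩
    linarith
  -- Cauchy-Schwarz over the `K` coordinates other than `i`.
  · have hcs : (σ - u) ^ 2 ≤ K * (∑ j, z j ^ 2 - u ^ 2) := by
      have h1 := sq_sum_le_card_mul_sum_sq (s := Finset.univ.erase i) (f := z)
      rw [Finset.card_erase_of_mem (Finset.mem_univ i), Finset.card_univ,
        Nat.cast_sub (by omega), Nat.cast_one] at h1
      have h2 := Finset.add_sum_erase Finset.univ z (Finset.mem_univ i)
      have h3 := Finset.add_sum_erase Finset.univ (fun j => z j ^ 2) (Finset.mem_univ i)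
      rw [show σ - u = ∑ j ∈ Finset.univ.erase i, z j by linarith,
        show ∑ j, z j ^ 2 - u ^ 2 = ∑ j ∈ Finset.univ.erase i, z j ^ 2 by
          rw [← h3]; simp [hu]]
      exact h1
    have hpos : 0 < u ^ 2 + σ ^ 2 := by
      rcases not_and_or.1 h0 with h | h <;> positivity
    -- Lower bound for `K` times the goal. It is definite when `|β * K - 2| < 2 * (K + 1)`, whose
    -- upper half is `hβK`.
    have hform : 0 < (K + 1) * (u ^ 2 + σ ^ 2) + (β * K - 2) * (u * σ) := by
      have hβK0 : 0 ≤ β * K := by positivity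
      rcases le_or_gt 0 (u * σ) with h | h
      · nlinarith [mul_nonneg hβK0 h, sq_nonneg (u - σ),
          mul_nonneg (sub_nonneg.2 hK1) hpos.le]
      · nlinarith [mul_pos (sub_pos.2 hβK) (neg_pos.2 h),
          mul_nonneg (show 0 ≤ K + 1 by linarith) (sq_nonneg (u + σ))]
    have : 0 < K * (β * u * σ + ∑ j, z j ^ 2 + σ ^ 2) := by linarith
    exact pos_of_mul_pos_right this (by linarith)

/-- The symmetrized Jacobian of the marginal costs is positive definite at positive loads. -/
theorem jacobian_pos {ι : Type*} [Fintype ι] (hN : 2 ≤ Fintype.card ι) {β : ℝ}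
    (hβ0 : 0 ≤ β) (hβ : β < 2 + 4 / ((Fintype.card ι : ℝ) - 1)) {z x : ι → ℝ} (hz : z ≠ 0)
    (hx : ∀ i, 0 ≤ x i) (hs : 0 < ∑ i, x i) :
    0 < β * (∑ i, x i * z i) * ∑ j, z j
      + (∑ i, x i) * ∑ j, z j ^ 2 + (∑ i, x i) * (∑ j, z j) ^ 2 := by
  -- Linearity in `x` reduces the claim to unit vectors.
  have h : β * (∑ i, x i * z i) * ∑ j, z j
      + (∑ i, x i) * ∑ j, z j ^ 2 + (∑ i, x i) * (∑ j, z j) ^ 2 =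
      ∑ i, x i * (β * z i * ∑ j, z j + ∑ j, z j ^ 2 + (∑ j, z j) ^ 2) := by
    generalize ∑ j, z j = σ
    generalize ∑ j, z j ^ 2 = Q
    simp only [Finset.mul_sum, Finset.sum_mul, ← Finset.sum_add_distrib]
    exact Finset.sum_congr rfl fun i _ => by ring
  rw [h]
  obtain ⟨i, -, hi⟩ := Finset.exists_lt_of_sum_lt (s := Finset.univ) (f := fun _ : ι => (0 : ℝ))
    (g := x) (by simpa using hs)
  exact Finset.sum_pos'
    (fun i _ => mul_nonneg (hx i) (jacobian_vertex_pos hN hβ0 hβ hz i).le)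
    ⟨i, Finset.mem_univ i, mul_pos hi (jacobian_vertex_pos hN hβ0 hβ hz i)⟩

/-- The marginal costs of a single slot are strictly monotone in the nonnegative loads. -/
theorem marginal_strictMonotone {ι : Type*} [Fintype ι] (hN : 2 ≤ Fintype.card ι) {a b c : ℝ}
    (ha : 0 < a) (hb : 1 ≤ b) (hbN : b < 3 + 4 / ((Fintype.card ι : ℝ) - 1))
    {x y : ι → ℝ} (hx : ∀ i, 0 ≤ x i) (hy : ∀ i, 0 ≤ y i) (hxy : x ≠ y) :
    0 < ∑ i, ((a * b * (∑ j, x j) ^ (b - 1) * x i + (a * (∑ j, x j) ^ b + c)) -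
      (a * b * (∑ j, y j) ^ (b - 1) * y i + (a * (∑ j, y j) ^ b + c))) * (x i - y i) := by
  set z : ι → ℝ := fun i => x i - y i with hz
  have hz0 : z ≠ 0 := fun h => hxy (funext fun i => sub_eq_zero.1 (congrFun h i))
  set σ := ∑ i, z i with hσ
  set Y := ∑ i, y i with hY
  set Q := ∑ i, z i ^ 2 with hQ
  set P := ∑ i, y i * z i with hP
  have hXY : ∑ i, x i = Y + σ := by
    rw [hY, hσ, ← Finset.sum_add_distrib]
    exact Finset.sum_congr rfl fun i _ => by simp [hz]
  -- The marginal costs at `y + θ z`, paired with `z`; the claim is `φ 0 < φ 1`.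
  set φ : ℝ → ℝ := fun θ =>
    a * b * (Y + θ * σ) ^ (b - 1) * (P + θ * Q) + (a * (Y + θ * σ) ^ b + c) * σ with hφ
  have hφ0 : φ 0 = ∑ i, (a * b * Y ^ (b - 1) * y i + (a * Y ^ b + c)) * z i := by
    simp only [hφ, zero_mul, add_zero, add_mul, Finset.sum_add_distrib, ← Finset.mul_sum,
      hP, hσ, mul_assoc]
  have hφ1 : φ 1 = ∑ i, (a * b * (Y + σ) ^ (b - 1) * x i + (a * (Y + σ) ^ b + c)) * z i := by
    have : P + Q = ∑ i, x i * z i := by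
      rw [hP, hQ, ← Finset.sum_add_distrib]
      exact Finset.sum_congr rfl fun i _ => by simp only [hz]; ring
    simp only [hφ, one_mul, this, add_mul, Finset.sum_add_distrib, ← Finset.mul_sum,
      hσ, mul_assoc]
  have hgoal : φ 0 < φ 1 := by
    have hcont : Continuous φ := by
      have h1 : Continuous fun θ : ℝ => (Y + θ * σ) ^ (b - 1) :=
        (Real.continuous_rpow_const (by linarith)).comp (by fun_prop)
      have h2 : Continuous fun θ : ℝ => (Y + θ * σ) ^ b :=
        (Real.continuous_rpow_const (by linarith)).comp (by fun_prop)
      exact ((continuous_const.mul h1).mul (by fun_prop)).add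
        (((continuous_const.mul h2).add continuous_const).mul continuous_const)
    refine strictMonoOn_of_deriv_pos (convex_Icc (0 : ℝ) 1) hcont.continuousOn ?_
      (by simp) (by simp) one_pos
    intro θ hθ
    rw [interior_Icc] at hθ
    have hpt : ∀ i, y i + θ * z i = (1 - θ) * y i + θ * x i := fun i => by simp only [hz]; ring
    have hpt0 : ∀ i, 0 ≤ y i + θ * z i := fun i => by
      rw [hpt]
      exact add_nonneg (mul_nonneg (by linarith [hθ.2]) (hy i)) (mul_nonneg hθ.1.le (hx i))
    have hsum : ∑ i, (y i + θ * z i) = Y + θ * σ := by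
      rw [Finset.sum_add_distrib, ← Finset.mul_sum]
    -- Zero total load inside the segment would force `x = y = 0`. Positivity is needed to
    -- differentiate the power `b - 1`, which may be below one.
    have hs : 0 < Y + θ * σ := by
      rw [← hsum]
      refine (Finset.sum_nonneg fun i _ => hpt0 i).lt_of_ne fun h => hxy ?_
      funext i
      have h1 := (Finset.sum_eq_zero_iff_of_nonneg fun i _ => hpt0 i).1 h.symm i
        (Finset.mem_univ i)
      rw [hpt] at h1
      have h2 : 0 ≤ (1 - θ) * y i := mul_nonneg (by linarith [hθ.2]) (hy i)
      have h3 : 0 ≤ θ * x i := mul_nonneg hθ.1.le (hx i)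
      have h4 : y i = 0 := (mul_eq_zero.1 (by linarith : (1 - θ) * y i = 0)).resolve_left
        (by linarith [hθ.2])
      have h5 : x i = 0 := (mul_eq_zero.1 (by linarith : θ * x i = 0)).resolve_left hθ.1.ne'
      rw [h4, h5]
    have hd0 : HasDerivAt (fun θ : ℝ => Y + θ * σ) σ θ := by
      simpa using ((hasDerivAt_id θ).mul_const σ).const_add Y
    have hd1 : HasDerivAt (fun θ : ℝ => P + θ * Q) Q θ := by
      simpa using ((hasDerivAt_id θ).mul_const Q).const_add P
    have hd := (((hd0.rpow_const (p := b - 1) (Or.inl hs.ne')).const_mul (a * b)).mul hd1).add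
      ((((hd0.rpow_const (p := b) (Or.inl hs.ne')).const_mul a).add_const c).mul_const σ)
    have hjac := jacobian_pos hN (β := b - 1) (by linarith) (by linarith) hz0 hpt0
      (by rw [hsum]; exact hs)
    rw [hsum] at hjac
    have hpz : ∑ i, (y i + θ * z i) * z i = P + θ * Q := by
      rw [hP, hQ, Finset.mul_sum, ← Finset.sum_add_distrib]
      exact Finset.sum_congr rfl fun i _ => by ring
    rw [hpz] at hjac
    have hpow : (Y + θ * σ) ^ (b - 1) = (Y + θ * σ) ^ (b - 1 - 1) * (Y + θ * σ) := by
      rw [Real.rpow_sub_one hs.ne' (b - 1)]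
      field_simp
    have hpos := mul_pos (mul_pos (mul_pos ha (show 0 < b by linarith))
      (Real.rpow_pos_of_pos hs (b - 1 - 1))) hjac
    refine lt_of_lt_of_eq hpos (Eq.trans ?_ hd.deriv.symm)
    rw [hpow]
    ring
  rw [hφ0, hφ1] at hgoal
  rw [hXY]
  have := sub_pos.2 hgoal
  rw [← Finset.sum_sub_distrib] at this
  simpa only [← sub_mul] using this

/-- The tangent line inequality for powers with exponent at least one. -/
theorem rpow_add_mul_sub_le {b s u : ℝ} (hb : 1 ≤ b) (hs : 0 ≤ s) (hu : 0 ≤ u) :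
    s ^ b + b * s ^ (b - 1) * (u - s) ≤ u ^ b := by
  rcases hs.eq_or_lt with rfl | hs
  -- At `s = 0` the case `b = 1` is separate because `0 ^ 0 = 1`; for `s > 0` the claim is
  -- Bernoulli's inequality at `u / s`.
  · rcases hb.eq_or_lt with rfl | hb'
    · simp
    · rw [Real.zero_rpow (by linarith), Real.zero_rpow (by linarith)]
      simpa using Real.rpow_nonneg hu b
  · have h1 := one_add_mul_self_le_rpow_one_add (s := u / s - 1)
      (by linarith [div_nonneg hu hs.le]) hb
    rw [add_sub_cancel, Real.div_rpow hu hs.le, le_div_iff₀ (Real.rpow_pos_of_pos hs b)] at h1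
    refine le_of_eq_of_le ?_ h1
    rw [Real.rpow_sub_one hs.ne']
    field_simp

end Scalar

/-! ### Nash equilibria as solutions of a variational inequality. -/

namespace DSM

variable {N H : ℕ} {g : Game N H}

/-- The bill is a sum of functions of one coordinate each. Since `b ≥ 1`, the power is
differentiable at every real load, including the zero or negative loads that estimates may produce.
-/
theorem hasGradientAt_bill (hb : ∀ h, 1 ≤ g.b h) (x s : Load H) :
    HasGradientAt (fun y : Load H => g.bill y (y + (s - x)))
      (WithLp.toLp 2 fun h => g.a h * g.b h * s h ^ (g.b h - 1) * x h + g.price h (s h)) x := by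
  rw [hasGradientAt_iff_hasFDerivAt]
  have hterm : ∀ h, HasFDerivAt (fun y : Load H => g.price h ((y + (s - x)) h) * y h)
      ((g.a h * g.b h * s h ^ (g.b h - 1) * x h + g.price h (s h)) •
        (EuclideanSpace.proj h : Load H →L[ℝ] ℝ)) x := by
    intro h
    have hp : HasFDerivAt (fun y : Load H => y h) (EuclideanSpace.proj h : Load H →L[ℝ] ℝ) x :=
      (EuclideanSpace.proj h : Load H →L[ℝ] ℝ).hasFDerivAt
    have hd : HasDerivAt (fun r : ℝ => g.price h (r + (s h - x h)) * r)
        (g.a h * g.b h * s h ^ (g.b h - 1) * x h + g.price h (s h)) (x h) := by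
      have h1 : HasDerivAt (fun r : ℝ => r + (s h - x h)) 1 (x h) :=
        (hasDerivAt_id (x h)).add_const _
      have h2 := (((h1.rpow_const (p := g.b h) (Or.inr (hb h))).const_mul (g.a h)).add_const
        (g.c h)).mul (hasDerivAt_id (x h))
      refine h2.congr_deriv ?_
      simp only [Game.price, add_sub_cancel, id]
      ring
    exact hd.comp_hasFDerivAt x hp
  have := HasFDerivAt.fun_sum (u := Finset.univ) fun h _ => hterm h
  refine this.congr_fderiv ?_
  ext y
  simp [PiLp.inner_apply, mul_comm]

theorem gradBill_eq (hb : ∀ h, 1 ≤ g.b h) (x s : Load H) :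
    g.gradBill x s =
      WithLp.toLp 2 fun h => g.a h * g.b h * s h ^ (g.b h - 1) * x h + g.price h (s h) :=
  (hasGradientAt_bill hb x s).gradient

theorem continuous_gradBill (hb : ∀ h, 1 ≤ g.b h) :
    Continuous fun p : Load H × Load H => g.gradBill p.1 p.2 := by
  simp only [gradBill_eq hb, Game.price]
  refine (PiLp.continuous_toLp 2 _).comp (continuous_pi fun h => ?_)
  have h0 : Continuous fun p : Load H × Load H => p.2 h := by fun_prop
  have h1 : Continuous fun p : Load H × Load H => p.2 h ^ (g.b h - 1) :=
    (Real.continuous_rpow_const (by linarith [hb h])).comp h0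
  have h2 : Continuous fun p : Load H × Load H => p.2 h ^ g.b h :=
    (Real.continuous_rpow_const (by linarith [hb h])).comp h0
  exact ((continuous_const.mul h1).mul (by fun_prop)).add
    ((continuous_const.mul h2).add continuous_const)

theorem convex_feasible (n : Fin N) : Convex ℝ (g.feasible n) := by
  intro x hx y hy s t hs ht hst
  refine ⟨?_, fun h => ?_⟩
  · simp only [PiLp.add_apply, PiLp.smul_apply, smul_eq_mul, Finset.sum_add_distrib,
      ← Finset.mul_sum, hx.1, hy.1, ← add_mul, hst, one_mul]
  · exact convex_Icc (g.qmin n h) (g.qmax n h) (hx.2 h) (hy.2 h) hs ht hst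

theorem isCompact_feasible (n : Fin N) : IsCompact (g.feasible n) := by
  have hc : IsCompact (WithLp.toLp 2 '' Set.Icc (g.qmin n) (g.qmax n) : Set (Load H)) :=
    isCompact_Icc.image (PiLp.continuous_toLp 2 _)
  refine hc.of_isClosed_subset ?_ ?_
  · refine (isClosed_eq (by fun_prop) continuous_const).inter ?_
    have h : IsClosed (⋂ h, {x : Load H | g.qmin n h ≤ x h ∧ x h ≤ g.qmax n h}) :=
      isClosed_iInter fun h =>
        (isClosed_le continuous_const (by fun_prop)).and (isClosed_le (by fun_prop) continuous_const)
    have he : {x : Load H | ∀ h, g.qmin n h ≤ x h ∧ x h ≤ g.qmax n h} =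
        ⋂ h, {x : Load H | g.qmin n h ≤ x h ∧ x h ≤ g.qmax n h} := by
      ext x
      simp
    rw [← he] at h
    exact h
  · intro x hx
    exact ⟨WithLp.ofLp x, ⟨fun h => (hx.2 h).1, fun h => (hx.2 h).2⟩, rfl⟩

theorem sum_update (q : Fin N → Load H) (n : Fin N) (y : Load H) :
    ∑ m, Function.update q n y m = y + (∑ m, q m - q n) := by
  rw [Finset.sum_update_of_mem (Finset.mem_univ n),
    ← Finset.add_sum_erase Finset.univ q (Finset.mem_univ n), Finset.sdiff_singleton_eq_erase]
  abel

/-- In each slot, multiply the tangent inequality of the power by `y h ≥ 0`; what is left over is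
the price derivative times `(y h - x h) ^ 2`, which is nonnegative. -/
theorem bill_tangent_le (ha : ∀ h, 0 < g.a h) (hb : ∀ h, 1 ≤ g.b h) {x y s : Load H}
    (hs : ∀ h, 0 ≤ s h) (hy : ∀ h, 0 ≤ y h) (hsx : ∀ h, x h ≤ s h) :
    g.bill x s + inner ℝ (g.gradBill x s) (y - x) ≤ g.bill y (y + (s - x)) := by
  rw [gradBill_eq hb, PiLp.inner_apply]
  simp only [Game.bill, ← Finset.sum_add_distrib]
  refine Finset.sum_le_sum fun h _ => ?_
  simp only [PiLp.add_apply, PiLp.sub_apply, Game.price, RCLike.inner_apply, conj_trivial]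
  have h1 := rpow_add_mul_sub_le (hb h) (hs h)
    (show 0 ≤ y h + (s h - x h) by linarith [hy h, hsx h])
  have h2 := mul_le_mul_of_nonneg_right (mul_le_mul_of_nonneg_left h1 (ha h).le) (hy h)
  have h3 : 0 ≤ g.a h * g.b h * s h ^ (g.b h - 1) * (y h - x h) ^ 2 := by
    have := Real.rpow_nonneg (hs h) (g.b h - 1)
    have := (ha h).le
    have : 0 ≤ g.b h := by linarith [hb h]
    positivity
  nlinarith

/-- Nash equilibria are the solutions of the variational inequality of the gradients. -/
theorem isNash_iff (ha : ∀ h, 0 < g.a h) (hb : ∀ h, 1 ≤ g.b h) (hqmin : ∀ n h, 0 ≤ g.qmin n h)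
    {q : Fin N → Load H} (hq : ∀ n, q n ∈ g.feasible n) :
    g.IsNash q ↔ ∀ n, ∀ y ∈ g.feasible n,
      0 ≤ inner ℝ (g.gradBill (q n) (∑ m, q m)) (y - q n) := by
  have hnn : ∀ n, ∀ y ∈ g.feasible n, ∀ h, 0 ≤ y h := fun n y hy h =>
    (hqmin n h).trans (hy.2 h).1
  constructor
  · intro hN n y hy
    have hgrad := hasGradientAt_bill hb (q n) (∑ m, q m)
    have hmin : IsLocalMinOn (fun y : Load H => g.bill y (y + (∑ m, q m - q n)))
        (g.feasible n) (q n) := by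
      refine IsMinOn.localize fun y hy => ?_
      have := hN.2 n y hy
      rw [sum_update] at this
      simpa using this
    have := hmin.hasFDerivWithinAt_nonneg hgrad.hasFDerivAt.hasFDerivWithinAt
      (sub_mem_posTangentConeAt_of_segment_subset ((convex_feasible n).segment_subset (hq n) hy))
    rw [gradBill_eq hb]
    simpa using this
  · intro hvi
    refine ⟨hq, fun n y hy => ?_⟩
    rw [sum_update]
    have hle : ∀ h, q n h ≤ (∑ m, q m) h := fun h => by
      rw [WithLp.ofLp_sum, Finset.sum_apply]
      exact Finset.single_le_sum (fun m _ => hnn m _ (hq m) h) (Finset.mem_univ n)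
    have := bill_tangent_le ha hb (fun h => (hnn n _ (hq n) h).trans (hle h)) (hnn n y hy) hle
    linarith [hvi n y hy]

/-- The gradients of all consumers at a joint profile. -/
noncomputable def jointGrad (g : Game N H) (x : PiLp 2 (fun _ : Fin N => Load H)) :
    PiLp 2 (fun _ : Fin N => Load H) :=
  WithLp.toLp 2 fun n => g.gradBill (x n) (∑ m, x m)

/-- The feasible joint profiles. -/
def jointFeasible (g : Game N H) : Set (PiLp 2 (fun _ : Fin N => Load H)) :=
  {x | ∀ n, x n ∈ g.feasible n}

theorem convex_jointFeasible : Convex ℝ (jointFeasible g) := fun _ hx _ hy _ _ hs ht hst n =>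
  convex_feasible n (hx n) (hy n) hs ht hst

theorem isCompact_jointFeasible : IsCompact (jointFeasible g) := by
  have hc := (isCompact_univ_pi fun n => isCompact_feasible (g := g) n).image
    (PiLp.continuous_toLp 2 fun _ : Fin N => Load H)
  convert hc using 1
  ext x
  constructor
  · exact fun hx => ⟨WithLp.ofLp x, fun n _ => hx n, rfl⟩
  · rintro ⟨y, hy, rfl⟩ n
    exact hy n (Set.mem_univ n)

theorem continuous_jointGrad (hb : ∀ h, 1 ≤ g.b h) : Continuous (jointGrad g) := by
  have h : ∀ n, Continuous fun x : PiLp 2 (fun _ : Fin N => Load H) =>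
      g.gradBill (x n) (∑ m, x m) := by
    intro n
    have h1 : Continuous fun x : PiLp 2 (fun _ : Fin N => Load H) => (x n, ∑ m, x m) := by
      fun_prop
    have h2 := (continuous_gradBill (g := g) hb).comp h1
    exact h2
  exact (PiLp.continuous_toLp 2 _).comp (continuous_pi h)

theorem jointGrad_strictMonotone (hN : 2 ≤ N) (ha : ∀ h, 0 < g.a h) (hb : ∀ h, 1 ≤ g.b h)
    (hqmin : ∀ n h, 0 ≤ g.qmin n h) (hbN : ∀ h, g.b h < 3 + 4 / ((N : ℝ) - 1))
    {x y : PiLp 2 (fun _ : Fin N => Load H)} (hx : x ∈ jointFeasible g)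
    (hy : y ∈ jointFeasible g) (hxy : x ≠ y) :
    0 < inner ℝ (jointGrad g x - jointGrad g y) (x - y) := by
  have hnn : ∀ x ∈ jointFeasible g, ∀ h n, 0 ≤ x n h := fun x hx h n =>
    (hqmin n h).trans ((hx n).2 h).1
  have hsum : inner ℝ (jointGrad g x - jointGrad g y) (x - y) =
      ∑ h, ∑ n, ((g.a h * g.b h * (∑ m, x m h) ^ (g.b h - 1) * x n h +
        (g.a h * (∑ m, x m h) ^ g.b h + g.c h)) -
        (g.a h * g.b h * (∑ m, y m h) ^ (g.b h - 1) * y n h +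
        (g.a h * (∑ m, y m h) ^ g.b h + g.c h))) * (x n h - y n h) := by
    rw [PiLp.inner_apply, Finset.sum_comm]
    refine Finset.sum_congr rfl fun n _ => ?_
    rw [PiLp.inner_apply]
    refine Finset.sum_congr rfl fun h _ => ?_
    simp [jointGrad, gradBill_eq hb, Game.price, mul_comm]
  have hcard : Fintype.card (Fin N) = N := Fintype.card_fin N
  have hpos : ∀ h, (fun n => x n h) ≠ (fun n => y n h) → _ := fun h hne =>
    marginal_strictMonotone (c := g.c h) (by rw [hcard]; exact hN) (ha h) (hb h)
      (by rw [hcard]; exact hbN h) (hnn x hx h) (hnn y hy h) hne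
  rw [hsum]
  obtain ⟨h, hh⟩ : ∃ h, (fun n => x n h) ≠ (fun n => y n h) := by
    by_contra! hcon
    refine hxy ?_
    ext n h
    exact congrFun (hcon h) n
  refine Finset.sum_pos' (fun h _ => ?_) ⟨h, Finset.mem_univ h, hpos h hh⟩
  by_cases hne : (fun n => x n h) = (fun n => y n h)
  · simp only [fun n => congrFun hne n, sub_self, mul_zero, Finset.sum_const_zero, le_refl]
  · exact (hpos h hne).le

/-- Nash equilibria are the solutions of the joint variational inequality. -/
theorem isNash_iff_joint (ha : ∀ h, 0 < g.a h) (hb : ∀ h, 1 ≤ g.b h)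
    (hqmin : ∀ n h, 0 ≤ g.qmin n h) {q : Fin N → Load H} :
    g.IsNash q ↔ WithLp.toLp 2 q ∈ jointFeasible g ∧ ∀ y ∈ jointFeasible g,
      0 ≤ inner ℝ (jointGrad g (WithLp.toLp 2 q)) (y - WithLp.toLp 2 q) := by
  constructor
  · intro hq
    refine ⟨hq.1, fun y hy => ?_⟩
    rw [PiLp.inner_apply]
    exact Finset.sum_nonneg fun n _ => (isNash_iff ha hb hqmin hq.1).1 hq n (y n) (hy n)
  · rintro ⟨hq, hvi⟩
    refine (isNash_iff ha hb hqmin hq).2 fun n y hy => ?_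
    -- A deviation of consumer `n` alone isolates the `n`-th summand.
    have hmem : WithLp.toLp 2 (Function.update q n y) ∈ jointFeasible g := by
      intro m
      rcases eq_or_ne m n with rfl | hne
      · simpa using hy
      · simpa [hne] using hq m
    have := hvi _ hmem
    rw [PiLp.inner_apply, Finset.sum_eq_single n] at this
    · simpa [jointGrad] using this
    · intro m _ hne
      simp [hne]
    · simp

end DSM

/-! ### Convergence of the agreement-based algorithm. -/

namespace DSM

variable {N H : ℕ} {g : Game N H}

/-- A projection onto a convex set moves no farther from the points of the set. -/
theorem IsProjection.norm_sub_le {K : Set (Load H)} (hK : Convex ℝ K) {u x y : Load H}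
    (h : IsProjection K u x) (hy : y ∈ K) : ‖x - y‖ ≤ ‖u - y‖ := by
  have hinf : ‖u - x‖ = ⨅ z : K, ‖u - z‖ := by
    have : Nonempty K := ⟨⟨x, h.1⟩⟩
    refine le_antisymm (le_ciInf fun z => h.2 z z.2) ?_
    exact ciInf_le (f := fun z : K => ‖u - z‖)
      ⟨0, by rintro _ ⟨z, rfl⟩; exact norm_nonneg _⟩ ⟨x, h.1⟩
  have hin := (norm_eq_iInf_iff_real_inner_le_zero hK h.1).1 hinf y hy
  refine le_of_sq_le_sq ?_ (norm_nonneg _)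
  have h1 : ‖u - y‖ ^ 2 = ‖u - x‖ ^ 2 - 2 * inner ℝ (u - x) (y - x) + ‖x - y‖ ^ 2 := by
    rw [show u - y = (u - x) - (y - x) by abel, norm_sub_sq_real, norm_sub_rev y x]
  nlinarith [sq_nonneg ‖u - x‖]

theorem mix_eq {M : SimpleGraph (Fin N)} [DecidableRel M.Adj] {w : Fin N → Fin N → ℝ}
    (hw : ∀ n k, ¬ M.Adj n k → n ≠ k → w n k = 0) (v : Fin N → Load H) (n : Fin N) :
    mix M w v n = ∑ k, w n k • v k := by
  have hn : n ∉ M.neighborFinset n := by simp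
  rw [mix, ← Finset.sum_insert hn (f := fun k => w n k • v k)]
  refine Finset.sum_subset (Finset.subset_univ _) fun k _ hk => ?_
  rw [Finset.mem_insert, not_or, SimpleGraph.mem_neighborFinset] at hk
  rw [hw n k hk.2 (Ne.symm hk.1), zero_smul]

/-- The gradients of all consumers when consumer `n` misjudges the aggregate load by `d n`. -/
noncomputable def perturbedGrad (g : Game N H)
    (p : PiLp 2 (fun _ : Fin N => Load H) × PiLp 2 (fun _ : Fin N => Load H)) :
    PiLp 2 (fun _ : Fin N => Load H) :=
  WithLp.toLp 2 fun n => g.gradBill (p.1 n) (∑ m, p.1 m + p.2 n)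

theorem continuous_perturbedGrad (hb : ∀ h, 1 ≤ g.b h) : Continuous (perturbedGrad g) := by
  have h : ∀ n, Continuous fun p : PiLp 2 (fun _ : Fin N => Load H) ×
      PiLp 2 (fun _ : Fin N => Load H) => g.gradBill (p.1 n) (∑ m, p.1 m + p.2 n) := by
    intro n
    have h1 : Continuous fun p : PiLp 2 (fun _ : Fin N => Load H) ×
        PiLp 2 (fun _ : Fin N => Load H) => (p.1 n, ∑ m, p.1 m + p.2 n) := by
      fun_prop
    have h2 := (continuous_gradBill (g := g) hb).comp h1
    exact h2
  exact (PiLp.continuous_toLp 2 _).comp (continuous_pi h)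

theorem perturbedGrad_zero (x : PiLp 2 (fun _ : Fin N => Load H)) :
    perturbedGrad g (x, 0) = jointGrad g x := by
  simp [perturbedGrad, jointGrad]

end DSM

theorem proposition3 {N H : ℕ} (hN : 2 ≤ N) (g : DSM.Game N H)
    (ha : ∀ h, 0 < g.a h) (hb : ∀ h, 1 ≤ g.b h) (hc : ∀ h, 0 ≤ g.c h)
    (hqmin : ∀ n h, 0 ≤ g.qmin n h)
    (hbN : ∀ h, g.b h < 3 + 4 / ((N : ℝ) - 1))
    (M : SimpleGraph (Fin N)) [DecidableRel M.Adj] (hM : M.Connected)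
    (w : Fin N → Fin N → ℝ)
    (hw_nonneg : ∀ n k, 0 ≤ w n k)
    (hw_zero : ∀ n k, ¬ M.Adj n k → n ≠ k → w n k = 0)
    (hw_row : ∀ n, ∑ k, w n k = 1) (hw_col : ∀ k, ∑ n, w n k = 1)
    (hw_edge : ∀ n k, M.Adj n k → 0 < w n k)
    (hw_self : M.IsBipartite → ∃ n, 0 < w n n)
    (α : ℕ → ℝ) (hα_anti : AntitoneOn α (Set.Ici 1))
    (hα_div : Tendsto (fun T => ∑ t ∈ Finset.range T, α t) atTop atTop)
    (hα_sq : Summable (fun t => α t ^ 2))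
    (q v : ℕ → Fin N → DSM.Load H) (hrun : DSM.IsAgreementRun g M w α q v) :
    ∃ qstar : Fin N → DSM.Load H,
      g.IsNash qstar ∧ (∀ q', g.IsNash q' → q' = qstar) ∧ Tendsto q atTop (𝓝 qstar) := by

  have hne : Nonempty (Fin N) := ⟨⟨0, by omega⟩⟩
  obtain ⟨ρ, hρ0, hρ1, hρ⟩ := exists_averaging_contraction (E := DSM.Load H) hM hw_nonneg hw_row
    hw_col hw_edge hw_self
  -- Time is shifted by one, as the run starts at `t = 1`. `d t n` will be the error of consumer `n`
  -- about the total load.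
  set x : ℕ → PiLp 2 (fun _ : Fin N => DSM.Load H) := fun t => WithLp.toLp 2 (q (t + 1)) with hx
  set V : ℕ → PiLp 2 (fun _ : Fin N => DSM.Load H) := fun t => WithLp.toLp 2 (v (t + 1)) with hV
  set d : ℕ → PiLp 2 (fun _ : Fin N => DSM.Load H) := fun t =>
    (N : ℝ) • averaging (DSM.Load H) w (deviation (Fin N) (DSM.Load H) (V t)) with hd
  have hα0' : Tendsto α atTop (𝓝 0) := by
    rw [tendsto_zero_iff_abs_tendsto_zero]
    have := hα_sq.tendsto_atTop_zero.sqrt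
    simpa [Real.sqrt_sq_eq_abs, Function.comp_def] using this
  have hα0 : Tendsto (fun t => α (t + 1)) atTop (𝓝 0) := hα0'.comp (tendsto_add_atTop_nat 1)
  have hα : ∀ t, 0 ≤ α (t + 1) := by
    have : Antitone fun t => α (t + 1) := fun s t hst =>
      hα_anti (by simp) (by simp) (by omega)
    exact this.le_of_tendsto hα0
  have hdiv : Tendsto (fun T => ∑ t ∈ Finset.range T, α (t + 1)) atTop atTop := by
    have := tendsto_atTop_add_const_right atTop (-α 0) (hα_div.comp (tendsto_add_atTop_nat 1))
    refine this.congr fun T => ?_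
    simp [Finset.sum_range_succ']
  have hxK : ∀ t, x t ∈ DSM.jointFeasible g := by
    intro t n
    cases t with
    | zero => exact hrun.start_feasible n
    | succ t => exact (hrun.step_profile (t + 1) (by omega) n).1
  have hVstep : ∀ t, V (t + 1) = averaging (DSM.Load H) w (V t) + (x (t + 1) - x t) := by
    intro t
    ext1 n
    have := hrun.step_estimate (t + 1) (by omega) n
    rw [DSM.mix_eq hw_zero] at this
    simp [hV, hx, this, add_sub_assoc]
  -- Equal initial values and unit column sums keep the sum of the estimates equal to the true total
  -- load.
  have hmean : ∀ t, ∑ n, V t n = ∑ n, x t n := by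
    intro t
    induction t with
    | zero => simp [hV, hx, hrun.start_estimate]
    | succ t ih =>
      rw [hVstep]
      simp only [PiLp.add_apply, PiLp.sub_apply, Finset.sum_add_distrib, Finset.sum_sub_distrib,
        sum_averaging hw_col, ih]
      abel
  have hload : ∀ t n, (N : ℝ) • DSM.mix M w (v (t + 1)) n = ∑ m, x t m + d t n := by
    intro t n
    have hN0 : (N : ℝ) ≠ 0 := by positivity
    rw [DSM.mix_eq hw_zero, hd]
    simp only
    rw [← deviation_averaging hw_row hw_col, PiLp.smul_apply, deviation_apply,
      sum_averaging hw_col, hmean, Fintype.card_fin, smul_sub, smul_smul, mul_inv_cancel₀ hN0,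
      one_smul, add_sub_cancel, averaging_apply]
  have hstep : ∀ t, ∀ y ∈ DSM.jointFeasible g,
      ‖x (t + 1) - y‖ ≤ ‖x t - α (t + 1) • DSM.perturbedGrad g (x t, d t) - y‖ := by
    intro t y hy
    refine le_of_sq_le_sq ?_ (norm_nonneg _)
    rw [PiLp.norm_sq_eq_of_L2, PiLp.norm_sq_eq_of_L2]
    refine Finset.sum_le_sum fun n _ => pow_le_pow_left₀ (norm_nonneg _) ?_ 2
    have hp := hrun.step_profile (t + 1) (by omega) n
    rw [hload] at hp
    exact hp.norm_sub_le (DSM.convex_feasible n) (hy n)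
  have hmove : ∀ t, ‖x (t + 1) - x t‖ ≤ α (t + 1) * ‖DSM.perturbedGrad g (x t, d t)‖ := by
    intro t
    refine (hstep t _ (hxK t)).trans_eq ?_
    rw [sub_right_comm, sub_self, zero_sub, norm_neg, norm_smul, Real.norm_of_nonneg (hα t)]
  have hgrad : Tendsto (fun t => DSM.perturbedGrad g (x t, d t) - DSM.jointGrad g (x t)) atTop
      (𝓝 0) := by
    simpa only [DSM.perturbedGrad_zero] using tendsto_consensus_perturbation
      (DSM.continuous_perturbedGrad (g := g) hb) DSM.isCompact_jointFeasible hxK hw_row hw_col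
      hρ0 hρ1 hρ hVstep (Nat.cast_nonneg N) (fun t => rfl) hα hα0 hmove
  have hmono := fun x (hx : x ∈ DSM.jointFeasible g) y (hy : y ∈ DSM.jointFeasible g) =>
    DSM.jointGrad_strictMonotone hN ha hb hqmin hbN hx hy
  obtain ⟨z, hz, hvi, hlim⟩ := exists_tendsto_of_strictMonotone DSM.isCompact_jointFeasible
    DSM.convex_jointFeasible (DSM.continuous_jointGrad hb).continuousOn hmono hxK hα hdiv hα0
    hgrad hstep
  refine ⟨WithLp.ofLp z, (DSM.isNash_iff_joint ha hb hqmin).2 ⟨hz, hvi⟩, ?_, ?_⟩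
  · intro q' hq'
    obtain ⟨hq'K, hq'vi⟩ := (DSM.isNash_iff_joint ha hb hqmin).1 hq'
    by_contra hne'
    have hne'' : WithLp.toLp 2 q' ≠ z := fun h => hne' (by rw [← h])
    -- The inequalities of two solutions, each tested at the other, contradict strict monotonicity.
    have h1 := hmono _ hq'K _ hz hne''
    have h2 := hvi _ hq'K
    have h3 := hq'vi _ hz
    rw [← neg_sub, inner_neg_right] at h3
    rw [inner_sub_left] at h1
    linarith
  · rw [← tendsto_add_atTop_iff_nat 1]
    exact ((PiLp.continuous_ofLp 2 _).tendsto z).comp hlim
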